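/- For integers $n,m\ge 1$, an $m$-modular Hadamard matrix of size $n$, or $MH(n,m)$, is an $n\times n$ matrix $H$ with entries $\pm 1$ such that $HH^\top\equiv nI \pmod m$. Theorem. Let $p\equiv 3 \pmod 4$ be a prime such that $2$ is a primitive root modulo $p$, and let $r$ be an integer that is a quadratic residue modulo $p$ (so $p\nmid r$ and $r\equiv a^2 \pmod p$ for some integer $a$). Then for all but finitely many even positive integers $n$ with $n\equiv 2(1+r)\pmod p$, an $MH(n,p)$ exists. -/

import Mathlib

/-- `IsMH H m` says that the square integer matrix `H` of size `n` is an `m`-modular Hadamard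
matrix, an `MH(n, m)`: its entries are `±1`, and `H Hᵀ ≡ n I (mod m)` entrywise. -/
def IsMH {n : ℕ} (H : Matrix (Fin n) (Fin n) ℤ) (m : ℕ) : Prop :=
  (∀ i j, H i j = 1 ∨ H i j = -1) ∧
  ∀ i j, (H * H.transpose) i j ≡ ((n : ℤ) • (1 : Matrix (Fin n) (Fin n) ℤ)) i j [ZMOD (m : ℤ)]

/-!
The proof handles a class of sizes `N ≠ 0, 4` modulo `p`; in the class `0` the all-ones matrix `J` is
a modular Hadamard matrix, and in the class `4` the matrix `J - 2I` is one.

Growth. Let `C` be a `±1` matrix whose order and row sums are `1` modulo `p` and which satisfies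
`C Cᵀ ≡ N I + (1 - N) J`. Modulo `p` it imitates the `1 × 1` matrix `(1)`: if a diagonal entry `ε` of
an `MH(M, p)` with `M ≡ N` is replaced by `ε C`, and the rest of its row and column is repeated, the
result is an `MH(M + V, p)`, where `V + 1` is the order of `C` (`IsMHSize.expand`). Such a `C` is the
non-incidence matrix of points and hyperplanes in the projective space of dimension `p - 1` over
`ℤ/q`, where `q` is a prime with `q N ≡ 4`, which exists by Dirichlet's theorem: as `q ^ (p - 1) ≡ 1`,
its parameters are the required ones (`card_projectivization_eq_one`, `hyperplaneMatrix_sum_row`,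
`hyperplaneMatrix_sum_mul`). The step `V` is a multiple of `p` that depends on `N` only.

Starting points. It remains to find, for each even `n ≡ N`, one size of a modular Hadamard
matrix that is congruent to `n` modulo `V`. Since `2` is a primitive root, either `n` or `n / 2` is a
positive power of `4` modulo `p`. Tensor products of matrices `J - 2I` of orders `4` modulo `p` realize
every residue modulo `V` that is a positive power of `4` modulo `p` (`exists_isMHSize_modEq`), and in
the second case a further tensor product with the Hadamard matrix of order `2` is taken.
-/

/-! ### Sizes of modular Hadamard matrices -/

/-- `N` is the size of some `MH(N, p)`. -/
def IsMHSize (p N : ℕ) : Prop := ∃ H : Matrix (Fin N) (Fin N) ℤ, IsMH H p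

/-- The rows of a modular Hadamard matrix may be indexed by any finite type, and only distinct
rows need to be compared: the diagonal of `H Hᵀ` is the size of `H` as soon as the entries
are `±1`. -/
theorem IsMHSize.of_matrix {p : ℕ} {ι : Type*} [Fintype ι] (H : Matrix ι ι ℤ)
    (hH : ∀ i j, H i j = 1 ∨ H i j = -1)
    (h : ∀ i j, i ≠ j → ∑ k, (H i k : ZMod p) * H j k = 0) : IsMHSize p (Fintype.card ι) := by
  classical
  let e := Fintype.equivFin ι
  refine ⟨H.submatrix e.symm e.symm, fun i j => hH _ _, fun i j => ?_⟩
  rw [← ZMod.intCast_eq_intCast_iff]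
  simp only [Matrix.mul_apply, Matrix.transpose_apply, Matrix.submatrix_apply, Int.cast_sum,
    Int.cast_mul, Matrix.smul_apply, Matrix.one_apply]
  rw [e.symm.sum_comp fun k => (H (e.symm i) k : ZMod p) * H (e.symm j) k]
  split_ifs with hij
  · subst hij
    have hsq (k : ι) : (H (e.symm i) k : ZMod p) * H (e.symm i) k = 1 := by
      rcases hH (e.symm i) k with h | h <;> simp [h]
    simp [hsq]
  · simpa using h _ _ (e.symm.injective.ne hij)

theorem IsMH.sum_mul_eq {p N : ℕ} {H : Matrix (Fin N) (Fin N) ℤ} (hH : IsMH H p) (i j : Fin N) :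
    ∑ k, (H i k : ZMod p) * H j k = if i = j then (N : ZMod p) else 0 := by
  have h := (ZMod.intCast_eq_intCast_iff _ _ _).2 (hH.2 i j)
  simp only [Matrix.mul_apply, Matrix.transpose_apply, Int.cast_sum, Int.cast_mul,
    Matrix.smul_apply, Matrix.one_apply] at h
  rw [h]
  split_ifs <;> simp

theorem IsMHSize.mul {p M N : ℕ} (hM : IsMHSize p M) (hN : IsMHSize p N) :
    IsMHSize p (M * N) := by
  obtain ⟨A, hA⟩ := hM
  obtain ⟨B, hB⟩ := hN
  have := IsMHSize.of_matrix (p := p) (ι := Fin M × Fin N)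
    (fun i j => A i.1 j.1 * B i.2 j.2) (fun i j => by
      rcases hA.1 i.1 j.1 with h | h <;> rcases hB.1 i.2 j.2 with h' | h' <;> simp [h, h'])
    (fun i j hij => by
      have : ∑ k : Fin M × Fin N, ((A i.1 k.1 * B i.2 k.2 : ℤ) : ZMod p) *
          ((A j.1 k.1 * B j.2 k.2 : ℤ) : ZMod p) =
          (∑ k, (A i.1 k : ZMod p) * A j.1 k) * ∑ k, (B i.2 k : ZMod p) * B j.2 k := by
        rw [Finset.sum_mul_sum, ← Finset.sum_product']
        refine Finset.sum_congr rfl fun k _ => ?_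
        push_cast
        ring
      rw [this, hA.sum_mul_eq, hB.sum_mul_eq]
      rw [Ne, Prod.ext_iff, not_and_or] at hij
      rcases hij with h | h <;> simp [h])
  simpa using this

theorem isMHSize_one (p : ℕ) : IsMHSize p 1 := by
  simpa using IsMHSize.of_matrix (p := p) (ι := Fin 1) (fun _ _ => 1) (by simp)
    (fun i j h => absurd (Subsingleton.elim i j) h)

theorem IsMHSize.pow {p N : ℕ} (hN : IsMHSize p N) (k : ℕ) :
    IsMHSize p (N ^ k) := by
  induction k with
  | zero => simpa using isMHSize_one p
  | succ k ih => simpa [pow_succ] using ih.mul hN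

theorem isMHSize_two (p : ℕ) : IsMHSize p 2 := by
  simpa using IsMHSize.of_matrix (p := p) (ι := Fin 2) !![1, 1; 1, -1]
    (by intro i j; fin_cases i <;> fin_cases j <;> simp)
    (by intro i j; fin_cases i <;> fin_cases j <;> simp)

/-- The all-ones matrix. -/
theorem isMHSize_of_eq_zero {p N : ℕ} (hN : (N : ZMod p) = 0) : IsMHSize p N := by
  simpa using IsMHSize.of_matrix (p := p) (ι := Fin N) (fun _ _ => 1) (by simp) (by simp [hN])

/-- The matrix `J - 2I`, whose distinct rows have inner product `t - 4`. -/
theorem isMHSize_of_eq_four {p t : ℕ} (ht : (t : ZMod p) = 4) : IsMHSize p t := by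
  have := IsMHSize.of_matrix (p := p) (ι := Fin t) (fun i j => if i = j then -1 else 1)
    (fun i j => by split_ifs <;> simp)
    (fun i j hij => by
      have h (k : Fin t) : (((if i = k then -1 else 1 : ℤ) : ℤ) : ZMod p) *
          ((if j = k then -1 else 1 : ℤ) : ZMod p) =
          1 - 2 * (if i = k then 1 else 0) - 2 * (if j = k then 1 else 0) := by
        by_cases h1 : i = k <;> by_cases h2 : j = k
        · exact absurd (h1.trans h2.symm) hij
        all_goals simp [h1, h2]; try norm_num
      simp only [h, Finset.sum_sub_distrib, ← Finset.mul_sum, Finset.sum_ite_eq, Finset.mem_univ,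
        if_true, Finset.sum_const, Finset.card_univ, Fintype.card_fin, nsmul_eq_mul, ht]
      norm_num)
  simpa using this

/-! ### Expanding one entry of a modular Hadamard matrix -/

/-- Modulo `p`, the matrix `C` behaves like the `1 × 1` matrix `(1)`: its order and its row
sums are `1`, and `C Cᵀ = N I + (1 - N) J`. Replacing the diagonal entry `H i₀ i₀` by
`(H i₀ i₀) C`, and repeating the rest of row and column `i₀` accordingly, therefore preserves all
inner products of distinct rows, and those of the new rows with each other vanish. -/
theorem IsMHSize.expand {p N : ℕ} (hN : IsMHSize p N) (hN0 : N ≠ 0) {κ : Type*} [Fintype κ]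
    (C : Matrix κ κ ℤ) (hC : ∀ a b, C a b = 1 ∨ C a b = -1)
    (hcard : (Fintype.card κ : ZMod p) = 1) (hsum : ∀ a, ∑ b, (C a b : ZMod p) = 1)
    (hmul : ∀ a b, a ≠ b → ∑ c, (C a c : ZMod p) * C b c = 1 - N) :
    IsMHSize p (Fintype.card κ + (N - 1)) := by
  classical
  obtain ⟨H, hH⟩ := hN
  let i₀ : Fin N := ⟨0, Nat.pos_of_ne_zero hN0⟩
  have key (i j : Fin N) : (H i i₀ : ZMod p) * H j i₀ +
      ∑ k : {k : Fin N // k ≠ i₀}, (H i k : ZMod p) * H j k =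
      if i = j then (N : ZMod p) else 0 := by
    rw [← hH.sum_mul_eq, Fintype.sum_eq_add_sum_subtype_ne _ i₀]
  have hsq (i j : Fin N) : (H i j : ZMod p) * H i j = 1 := by
    rcases hH.1 i j with h | h <;> simp [h]
  have := IsMHSize.of_matrix (p := p) (ι := κ ⊕ {k : Fin N // k ≠ i₀})
    (Matrix.fromBlocks (.of fun a b => H i₀ i₀ * C a b) (.of fun _ k => H i₀ k)
      (.of fun k _ => H k i₀) (.of fun k l => H k l))
    (by
      rintro (a | i) (b | j)
      · rcases hH.1 i₀ i₀ with h | h <;> rcases hC a b with h' | h' <;> simp [h, h']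
      · exact hH.1 _ _
      · exact hH.1 _ _
      · exact hH.1 _ _)
    (by
      rintro (a | i) (b | j) hij <;>
        simp only [Fintype.sum_sum_type, Matrix.fromBlocks_apply₁₁, Matrix.fromBlocks_apply₁₂,
          Matrix.fromBlocks_apply₂₁, Matrix.fromBlocks_apply₂₂, Matrix.of_apply, Int.cast_mul]
      · have h := key i₀ i₀
        rw [hsq, if_pos rfl] at h
        have h1 (c : κ) : (H i₀ i₀ : ZMod p) * C a c * (H i₀ i₀ * C b c) = C a c * C b c := by
          linear_combination (C a c : ZMod p) * C b c * hsq i₀ i₀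
        simp only [h1]
        rw [hmul a b (by simpa using hij)]
        linear_combination h
      · have h := key i₀ j
        rw [if_neg j.2.symm] at h
        have h1 (c : κ) : (H i₀ i₀ : ZMod p) * C a c * H j i₀ = H i₀ i₀ * H j i₀ * C a c := by
          ring
        simp only [h1]
        rw [← Finset.mul_sum, hsum, mul_one, h]
      · have h := key i i₀
        rw [if_neg i.2] at h
        have h1 (c : κ) : (H i i₀ : ZMod p) * (H i₀ i₀ * C b c) = H i i₀ * H i₀ i₀ * C b c := by
          ring
        simp only [h1]
        rw [← Finset.mul_sum, hsum, mul_one, h]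
      · have h := key i j
        rw [if_neg fun h => hij (by rw [Subtype.ext h])] at h
        simpa [hcard] using h)
  have hc : Fintype.card {k : Fin N // k ≠ i₀} = N - 1 := by simp
  rwa [Fintype.card_sum, hc] at this

/-! ### The point-hyperplane matrix of a projective space -/

open scoped LinearAlgebra.Projectivization

/-- A linear map given by a matrix with independent rows is equidistributed. -/
theorem sum_comp_mulVec {R F : Type*} [CommRing R] [Field F] [Fintype F] [DecidableEq F]
    {k d : ℕ} (A : Matrix (Fin k) (Fin d) F) (hA : LinearIndependent F A.row)
    (g : (Fin k → F) → R) :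
    (Fintype.card F : R) ^ k * ∑ v, g (A.mulVec v) = (Fintype.card F : R) ^ d * ∑ w, g w := by
  classical
  have hsurj : Function.Surjective A.mulVecLin := by
    rw [← LinearMap.range_eq_top]
    apply Submodule.eq_top_of_finrank_eq
    have := hA.rank_matrix
    rw [Matrix.rank] at this
    simpa using this
  let K := (Finset.univ.filter fun v => A.mulVecLin v = 0).card
  have hfib (w : Fin k → F) : (Finset.univ.filter fun v => A.mulVecLin v = w).card = K := by
    have h := AddMonoidHom.card_fiber_eq_of_mem_range A.mulVecLin.toAddMonoidHom
      (x := w) (y := 0) (hsurj w) (hsurj 0)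
    exact h
  have hsum {S : Type _} [CommRing S] (f : (Fin k → F) → S) :
      ∑ v, f (A.mulVec v) = K * ∑ w, f w := by
    rw [← Finset.sum_fiberwise Finset.univ (fun v => A.mulVecLin v), Finset.mul_sum]
    refine Finset.sum_congr rfl fun w _ => ?_
    rw [Finset.sum_congr rfl (g := fun _ => f w), Finset.sum_const, hfib, nsmul_eq_mul]
    intro v hv
    rw [← (Finset.mem_filter.1 hv).2, Matrix.mulVecLin_apply]
  have hcard := hsum (S := R) fun _ => 1
  simp only [Finset.sum_const, Finset.card_univ, Fintype.card_fun, Fintype.card_fin,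
    nsmul_eq_mul, mul_one, Nat.cast_pow] at hcard
  rw [hsum, hcard]
  ring

/-- Each point of a projective space has `|Fˣ|` nonzero representatives. -/
theorem sum_eq_zero_add_sum_projectivization {R F V : Type*} [CommRing R] [Field F] [Fintype F]
    [AddCommGroup V] [Module F V] [Fintype V] [Fintype (ℙ F V)]
    (f : V → R) (hf : ∀ (c : Fˣ) v, f (c • v) = f v) :
    ∑ v, f v = f 0 + ((Fintype.card F : R) - 1) * ∑ y : ℙ F V, f y.rep := by
  classical
  have hb : Function.Bijective fun x : Fˣ × ℙ F V =>
      (⟨x.1 • x.2.rep, (smul_ne_zero_iff_ne x.1).2 x.2.rep_nonzero⟩ : {v : V // v ≠ 0}) := by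
    constructor
    · rintro ⟨c, y⟩ ⟨d, z⟩ h
      have h' : c • y.rep = d • z.rep := congrArg Subtype.val h
      have hyz : y = z := by
        rw [← y.mk_rep, ← z.mk_rep, Projectivization.mk_eq_mk_iff]
        exact ⟨c⁻¹ * d, by rw [mul_smul, ← h', inv_smul_smul]⟩
      subst hyz
      have hcd : (c : F) = d := smul_left_injective F y.rep_nonzero h'
      rw [Units.ext hcd]
    · rintro ⟨v, hv⟩
      obtain ⟨a, ha⟩ := Projectivization.exists_smul_eq_mk_rep F v hv
      exact ⟨(a⁻¹, Projectivization.mk F v hv), Subtype.ext (by simp [← ha])⟩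
  have hq : (Fintype.card Fˣ : R) = Fintype.card F - 1 := by
    rw [Fintype.card_units, Nat.cast_sub Fintype.card_pos, Nat.cast_one]
  rw [Fintype.sum_eq_add_sum_subtype_ne f 0, ← hb.sum_comp (fun v : {v : V // v ≠ 0} => f v.1),
    Fintype.sum_prod_type]
  simp [hf, hq]

/-- The sign that separates the scalar `0` from the nonzero scalars. -/
def zeroSign {F : Type*} [Zero F] [DecidableEq F] (x : F) : ℤ := if x = 0 then -1 else 1

/-- The `±1` matrix of non-incidence between the points and the hyperplanes of the projective
space of dimension `d - 1` over `F`; hyperplanes are identified with points by the dot product. -/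
noncomputable def hyperplaneMatrix (F : Type*) [Field F] [DecidableEq F] (d : ℕ) :
    Matrix (ℙ F (Fin d → F)) (ℙ F (Fin d → F)) ℤ :=
  fun x y => zeroSign (x.rep ⬝ᵥ y.rep)

section

variable {F : Type*} [Field F]

theorem zeroSign_eq_or [DecidableEq F] (x : F) : zeroSign x = 1 ∨ zeroSign x = -1 := by
  unfold zeroSign
  split_ifs <;> simp

theorem zeroSign_units_smul [DecidableEq F] (c : Fˣ) (x : F) : zeroSign (c • x) = zeroSign x := by
  simp [zeroSign, Units.smul_def]

variable [Fintype F]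

theorem sum_zeroSign [DecidableEq F] (R : Type*) [CommRing R] :
    ∑ x : F, (zeroSign x : R) = Fintype.card F - 2 := by
  have h (x : F) : (zeroSign x : R) = 1 - 2 * if x = 0 then 1 else 0 := by
    unfold zeroSign
    split_ifs <;> norm_num
  simp [h]

variable {p d : ℕ} [Fact p.Prime]

/-- The hypotheses say that `q = |F|` is different from `1` and (if nonzero) that `q ^ (d - 1) = 1`
modulo `p`; the number `(q ^ d - 1) / (q - 1)` of points is then `1` modulo `p`. -/
theorem card_projectivization_eq_one [Fintype (ℙ F (Fin d → F))]
    (hq1 : (Fintype.card F : ZMod p) ≠ 1)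
    (hqd : (Fintype.card F : ZMod p) ^ d = Fintype.card F) :
    (Fintype.card (ℙ F (Fin d → F)) : ZMod p) = 1 := by
  have h := sum_eq_zero_add_sum_projectivization (R := ZMod p) (F := F) (V := Fin d → F)
    (fun _ => 1) (fun _ _ => rfl)
  simp only [Finset.sum_const, Finset.card_univ, Fintype.card_fun, Fintype.card_fin,
    nsmul_eq_mul, mul_one, Nat.cast_pow, hqd] at h
  apply mul_left_cancel₀ (sub_ne_zero.2 hq1)
  linear_combination -h

theorem hyperplaneMatrix_sum_row [DecidableEq F] [Fintype (ℙ F (Fin d → F))]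
    (hq0 : (Fintype.card F : ZMod p) ≠ 0) (hq1 : (Fintype.card F : ZMod p) ≠ 1)
    (hqd : (Fintype.card F : ZMod p) ^ d = Fintype.card F) (x : ℙ F (Fin d → F)) :
    ∑ y, (hyperplaneMatrix F d x y : ZMod p) = 1 := by
  have h := sum_eq_zero_add_sum_projectivization (R := ZMod p) (F := F) (V := Fin d → F)
    (fun v => (zeroSign (x.rep ⬝ᵥ v) : ZMod p))
    (fun c v => by simp only [dotProduct_smul, zeroSign_units_smul])
  have h' := sum_comp_mulVec (R := ZMod p) (Matrix.of ![x.rep])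
    (LinearIndependent.of_subsingleton (0 : Fin 1) (by simpa using x.rep_nonzero))
    (fun w => (zeroSign (w 0) : ZMod p))
  have hsum : ∑ w : Fin 1 → F, (zeroSign (w 0) : ZMod p) = ∑ a : F, (zeroSign a : ZMod p) :=
    (Equiv.funUnique (Fin 1) F).sum_comp fun a => (zeroSign a : ZMod p)
  rw [hsum] at h'
  simp only [Matrix.mulVec, Matrix.of_apply, Matrix.cons_val_zero, pow_one, hqd, sum_zeroSign] at h'
  have h'' := mul_left_cancel₀ hq0 h'
  have h0 : (zeroSign (0 : F) : ZMod p) = -1 := by simp [zeroSign]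
  rw [h'', dotProduct_zero, h0] at h
  apply mul_left_cancel₀ (sub_ne_zero.2 hq1)
  simp only [hyperplaneMatrix]
  linear_combination -h

/-- For distinct `x` and `x'` the pair of dot products with `x` and `x'` is equidistributed on
`F × F`, so the sum over all nonzero vectors is `q ^ (d - 2) * (q - 2) ^ 2 - 1`. With `q ^ d = q`
and `q * N = 4` modulo `p` this is `(q - 1) * (1 - N)`. -/
theorem hyperplaneMatrix_sum_mul [DecidableEq F] [Fintype (ℙ F (Fin d → F))]
    (hq0 : (Fintype.card F : ZMod p) ≠ 0) (hq1 : (Fintype.card F : ZMod p) ≠ 1)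
    (hqd : (Fintype.card F : ZMod p) ^ d = Fintype.card F) {N : ZMod p}
    (hN : Fintype.card F * N = 4)
    {x x' : ℙ F (Fin d → F)} (hx : x ≠ x') :
    ∑ y, (hyperplaneMatrix F d x y : ZMod p) * hyperplaneMatrix F d x' y = 1 - N := by
  have h := sum_eq_zero_add_sum_projectivization (R := ZMod p) (F := F) (V := Fin d → F)
    (fun v => (zeroSign (x.rep ⬝ᵥ v) : ZMod p) * zeroSign (x'.rep ⬝ᵥ v))
    (fun c v => by simp only [dotProduct_smul, zeroSign_units_smul])
  have h' := sum_comp_mulVec (R := ZMod p) (Matrix.of ![x.rep, x'.rep])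
    (Projectivization.linearIndependent_pair_iff_ne.2 hx)
    (fun w => (zeroSign (w 0) : ZMod p) * zeroSign (w 1))
  have hsum : ∑ w : Fin 2 → F, (zeroSign (w 0) : ZMod p) * zeroSign (w 1) =
      (∑ a : F, (zeroSign a : ZMod p)) * ∑ b : F, (zeroSign b : ZMod p) := by
    rw [Finset.sum_mul_sum, ← Fintype.sum_prod_type']
    exact (finTwoArrowEquiv F).sum_comp fun w => (zeroSign w.1 : ZMod p) * zeroSign w.2
  rw [hsum] at h'
  simp only [Matrix.mulVec, Matrix.of_apply, Matrix.cons_val_zero, Matrix.cons_val_one, hqd,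
    sum_zeroSign] at h'
  have h0 : (zeroSign (0 : F) : ZMod p) = -1 := by simp [zeroSign]
  rw [dotProduct_zero, dotProduct_zero, h0] at h
  apply mul_left_cancel₀ (mul_ne_zero (pow_ne_zero 2 hq0) (sub_ne_zero.2 hq1))
  simp only [hyperplaneMatrix]
  linear_combination h' - (Fintype.card F : ZMod p) ^ 2 * h +
    ((Fintype.card F : ZMod p)) * ((Fintype.card F : ZMod p) - 1) * hN

end

/-! ### All large sizes in a residue class -/

theorem zmod_two_ne_zero {p : ℕ} [Fact p.Prime] (hp2 : p ≠ 2) : (2 : ZMod p) ≠ 0 := by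
  refine fun h => hp2 ((Nat.prime_dvd_prime_iff_eq Fact.out Nat.prime_two).1 ?_)
  rw [← ZMod.natCast_eq_zero_iff]
  exact_mod_cast h

theorem zmod_four_ne_zero {p : ℕ} [Fact p.Prime] (hp2 : p ≠ 2) : (4 : ZMod p) ≠ 0 := by
  have h4 : (4 : ZMod p) = 2 ^ 2 := by norm_num
  exact h4 ▸ pow_ne_zero 2 (zmod_two_ne_zero hp2)

/-- A single step length `V` works for all sizes in the residue class `N` modulo `p`. -/
theorem exists_isMHSize_add {p : ℕ} [Fact p.Prime] (hp2 : p ≠ 2) {N : ZMod p}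
    (hN0 : N ≠ 0) (hN4 : N ≠ 4) :
    ∃ V : ℕ, 0 < V ∧ p ∣ V ∧
      ∀ M : ℕ, (M : ZMod p) = N → IsMHSize p M → IsMHSize p (M + V) := by
  classical
  have hp : p.Prime := Fact.out
  have h40 := zmod_four_ne_zero hp2
  obtain ⟨q, -, hq, hqN⟩ := Nat.forall_exists_prime_gt_and_eq_mod
    (a := 4 / N) (div_ne_zero h40 hN0).isUnit 0
  have : Fact q.Prime := ⟨hq⟩
  have : Fintype (ℙ (ZMod q) (Fin p → ZMod q)) := Fintype.ofFinite _
  have hcardF : (Fintype.card (ZMod q) : ZMod p) = 4 / N := by rw [ZMod.card, hqN]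
  have hq0 : (Fintype.card (ZMod q) : ZMod p) ≠ 0 := hcardF ▸ div_ne_zero h40 hN0
  have hq1 : (Fintype.card (ZMod q) : ZMod p) ≠ 1 := by
    rw [hcardF, Ne, div_eq_one_iff_eq hN0]
    exact hN4.symm
  have hqd : (Fintype.card (ZMod q) : ZMod p) ^ p = Fintype.card (ZMod q) := ZMod.pow_card _
  have hqN' : (Fintype.card (ZMod q) : ZMod p) * N = 4 := by rw [hcardF, div_mul_cancel₀ _ hN0]
  have hv := card_projectivization_eq_one (F := ZMod q) (d := p) hq1 hqd
  have hv1 : 1 < Fintype.card (ℙ (ZMod q) (Fin p → ZMod q)) := by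
    rw [Fintype.card_eq_nat_card,
      Projectivization.card_of_finrank (ZMod q) (Fin p → ZMod q) (n := p) (by simp)]
    calc 1 < ∑ i ∈ Finset.range 2, Nat.card (ZMod q) ^ i := by
          simp [Finset.sum_range_succ, hq.pos]
      _ ≤ _ := Finset.sum_le_sum_of_subset (Finset.range_subset_range.2 hp.two_le)
  refine ⟨Fintype.card (ℙ (ZMod q) (Fin p → ZMod q)) - 1, by lia, ?_, fun M hM h => ?_⟩
  · rw [← ZMod.natCast_eq_zero_iff, Nat.cast_sub hv1.le, hv, Nat.cast_one, sub_self]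
  · have hM0 : M ≠ 0 := by
      rintro rfl
      exact hN0 (by simpa using hM.symm)
    have := h.expand hM0 (hyperplaneMatrix (ZMod q) p) (fun _ _ => zeroSign_eq_or _) hv
      (hyperplaneMatrix_sum_row hq0 hq1 hqd)
      (fun _ _ hab => hyperplaneMatrix_sum_mul hq0 hq1 hqd (hM ▸ hqN') hab)
    convert this using 1
    lia

/-- Tensor products of matrices `J - 2I` of orders `t, u, …, u`, all `4` modulo `p`. With `u` coprime
to `V`, the order `t` can be adjusted modulo `V`. -/
theorem exists_isMHSize_modEq {p : ℕ} [Fact p.Prime] (hp2 : p ≠ 2) {V : ℕ} (hV : 0 < V)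
    (hpV : p ∣ V) {m i : ℕ} (hm : (m : ZMod p) = 4 ^ (i + 1)) :
    ∃ M : ℕ, IsMHSize p M ∧ M ≡ m [MOD V] := by
  have h40 := zmod_four_ne_zero hp2
  obtain ⟨u, huV, hu, hu4⟩ := Nat.forall_exists_prime_gt_and_eq_mod h40.isUnit V
  have huV' : u.Coprime V :=
    (hu.coprime_iff_not_dvd).2 fun h => absurd (Nat.le_of_dvd hV h) (by lia)
  have : NeZero V := ⟨hV.ne'⟩
  let t := ((m : ZMod V) * ((u : ZMod V)⁻¹) ^ i).val
  have ht : t * u ^ i ≡ m [MOD V] := by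
    rw [← ZMod.natCast_eq_natCast_iff]
    push_cast
    rw [ZMod.natCast_zmod_val, mul_assoc, ← mul_pow, mul_comm _ (u : ZMod V),
      ZMod.coe_mul_inv_eq_one u huV', one_pow, mul_one]
  refine ⟨t * u ^ i, (isMHSize_of_eq_four ?_).mul ((isMHSize_of_eq_four hu4).pow i), ht⟩
  have := (ZMod.natCast_eq_natCast_iff _ _ _).2 (ht.of_dvd hpV)
  push_cast at this
  rw [hu4, hm, pow_succ'] at this
  exact mul_right_cancel₀ (pow_ne_zero i h40) this

/-- If the sizes of modular Hadamard matrices in the class `N` are closed under `M ↦ M + V`, then one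
such size in each class modulo `V` that meets `Q` suffices. -/
theorem finite_setOf_not_isMHSize {p V : ℕ} (hV : 0 < V) (hpV : p ∣ V) {N : ZMod p} (Q : ℕ → Prop)
    (hadd : ∀ M : ℕ, (M : ZMod p) = N → IsMHSize p M → IsMHSize p (M + V))
    (hbase : ∀ n, Q n → (n : ZMod p) = N → ∃ M, IsMHSize p M ∧ M ≡ n [MOD V]) :
    {n : ℕ | Q n ∧ (n : ZMod p) = N ∧ ¬ IsMHSize p n}.Finite := by
  have hiter (M : ℕ) (hM : (M : ZMod p) = N) (h : IsMHSize p M) (j : ℕ) :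
      IsMHSize p (M + V * j) := by
    induction j with
    | zero => simpa using h
    | succ j ih =>
      rw [Nat.mul_succ, ← add_assoc]
      refine hadd _ ?_ ih
      have : (V : ZMod p) = 0 := (ZMod.natCast_eq_zero_iff _ _).2 hpV
      simp [hM, this]
  have hclass (ρ : ℕ) : {n : ℕ | (Q n ∧ (n : ZMod p) = N ∧ ¬ IsMHSize p n) ∧ n % V = ρ}.Finite := by
    rcases Set.eq_empty_or_nonempty
      {n : ℕ | (Q n ∧ (n : ZMod p) = N ∧ ¬ IsMHSize p n) ∧ n % V = ρ} with h | ⟨n₀, h₀, hρ⟩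
    · rw [h]
      exact Set.finite_empty
    · obtain ⟨M, hM, hMn⟩ := hbase n₀ h₀.1 h₀.2.1
      refine (Set.finite_Iio M).subset ?_
      rintro n ⟨⟨-, hnN, hn⟩, hnρ⟩
      by_contra hlt
      have hle : M ≤ n := not_lt.1 hlt
      have hmod : M ≡ n [MOD V] := hMn.trans (hρ.trans hnρ.symm)
      obtain ⟨j, hj⟩ := (Nat.modEq_iff_dvd' hle).1 hmod
      have hMN : (M : ZMod p) = N := by
        rw [← hnN, ZMod.natCast_eq_natCast_iff]
        exact hmod.of_dvd hpV
      refine hn ?_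
      have := hiter M hMN hM j
      rwa [← hj, Nat.add_sub_cancel' hle] at this
  refine ((Set.finite_lt_nat V).biUnion fun ρ _ => hclass ρ).subset fun n hn => ?_
  exact Set.mem_biUnion (Nat.mod_lt n hV) ⟨hn, rfl⟩

theorem finite_setOf_even_not_isMHSize {p : ℕ} [Fact p.Prime] (hp2 : p ≠ 2)
    (h2 : IsPrimitiveRoot (2 : ZMod p) (p - 1)) (N : ZMod p) :
    {n : ℕ | Even n ∧ (n : ZMod p) = N ∧ ¬ IsMHSize p n}.Finite := by
  have hp : p.Prime := Fact.out
  have h20 := zmod_two_ne_zero hp2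
  have h4 : (4 : ZMod p) = 2 ^ 2 := by norm_num
  have h40 : (4 : ZMod p) ≠ 0 := zmod_four_ne_zero hp2
  rcases eq_or_ne N 0 with rfl | hN0
  · exact Set.Finite.subset Set.finite_empty fun n hn => hn.2.2 (isMHSize_of_eq_zero hn.2.1)
  rcases eq_or_ne N 4 with rfl | hN4
  · exact Set.Finite.subset Set.finite_empty fun n hn => hn.2.2 (isMHSize_of_eq_four hn.2.1)
  obtain ⟨V, hV, hpV, hadd⟩ := exists_isMHSize_add hp2 hN0 hN4
  refine finite_setOf_not_isMHSize hV hpV Even hadd fun n hn hnN => ?_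
  have : NeZero (p - 1) := ⟨by have := hp.two_le; lia⟩
  obtain ⟨j, -, hj⟩ := h2.eq_pow_of_pow_eq_one (ZMod.pow_card_sub_one_eq_one (div_ne_zero hN0 h40))
  rw [eq_div_iff h40] at hj
  obtain ⟨i, rfl | rfl⟩ := j.even_or_odd'
  · refine exists_isMHSize_modEq hp2 hV hpV (i := i) ?_
    rw [hnN, ← hj, pow_mul, ← h4, pow_succ]
  -- An odd power of `2` is `2` times a power of `4`; the factor `2` is split off from `n` itself.
  · obtain ⟨m, rfl⟩ := hn.two_dvd
    obtain ⟨M, hM, hMm⟩ := exists_isMHSize_modEq hp2 hV hpV (m := m) (i := i) (by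
      apply mul_left_cancel₀ h20
      push_cast at hnN
      rw [hnN, ← hj, pow_succ, pow_mul, ← h4]
      ring)
    exact ⟨2 * M, (isMHSize_two p).mul hM, hMm.mul_left 2⟩

theorem mainTheorem2 (p : ℕ) (hp : p.Prime) (hp4 : p ≡ 3 [MOD 4])
    (h2 : IsPrimitiveRoot (2 : ZMod p) (p - 1))
    (r : ℤ) (hr0 : ¬ (p : ℤ) ∣ r) (hr : ∃ a : ℤ, a ^ 2 ≡ r [ZMOD (p : ℤ)]) :
    {n : ℕ | Even n ∧ (n : ℤ) ≡ 2 * (1 + r) [ZMOD (p : ℤ)] ∧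
      ¬ ∃ H : Matrix (Fin n) (Fin n) ℤ, IsMH H p}.Finite := by
  have : Fact p.Prime := ⟨hp⟩
  have hp2 : p ≠ 2 := by
    rintro rfl
    exact absurd hp4 (by decide)
  refine (finite_setOf_even_not_isMHSize hp2 h2 ((2 * (1 + r) : ℤ) : ZMod p)).subset ?_
  rintro n ⟨hn, hnr, hnH⟩
  refine ⟨hn, ?_, hnH⟩
  simpa using (ZMod.intCast_eq_intCast_iff _ _ _).2 hnr
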